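/- Let $\Delta$ be a finite alphabet. A nonempty word $x$ is a \emph{period} of a finite word $w$ if $w = x^n x'$ for some $n \ge 1$ and some prefix $x'$ of $x$; the \emph{exponent} $\exp(w)$ of a nonempty word $w$ is $|w|/|x|$, where $x$ is the shortest period of $w$. A sequence $\mathbf{a} = (a_i)_{i \ge 0}$ over $\Delta$ is \emph{$k$-automatic}, for an integer $k \ge 2$, if there is a deterministic finite automaton with output that, for every $n \geq 0$, on reading the base-$k$ representation of $n$ (most significant digit first, without leading zeros), reaches a state whose output is $a_n$. \textbf{Theorem.} If $\mathbf{a} = (a_i)_{i \ge 0}$ is a $k$-automatic sequence, the quantity $$c_1(\mathbf{a}) := \sup\{\exp(w) : w \text{ is a nonempty finite factor of } \mathbf{a} \text{ that occurs infinitely often in } \mathbf{a}\}$$ is either rational or infinite. Moreover it is computable: there is a single algorithm (a total recursive function) that, given $k \geq 2$ and a deterministic finite automaton with output generating a $k$-automatic sequence $\mathbf{a}$, decides whether $c_1(\mathbf{a}) = \infty$ and, if it is finite, outputs natural numbers $p$ and $q > 0$ with $c_1(\mathbf{a}) = p/q$. -/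

import Mathlib

/-! Words, periods and exponents -/

/-- The nonempty word `x` is a period of `w`: `w = x ^ n x'` with `n ≥ 1` and `x'` a prefix
of `x`. -/
def IsWordPeriod {Δ : Type*} (x w : List Δ) : Prop :=
  x ≠ [] ∧ ∃ n : ℕ, 1 ≤ n ∧ ∃ x' : List Δ, x' <+: x ∧ w = (List.replicate n x).flatten ++ x'

/-- The length of the shortest period of `w`. A nonempty word is a period of itself. -/
noncomputable def leastPeriodLength {Δ : Type*} (w : List Δ) : ℕ :=
  sInf {p : ℕ | ∃ x : List Δ, IsWordPeriod x w ∧ x.length = p}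

/-- The exponent `exp(w) = |w| / |x|`, for `x` the shortest period of the nonempty word `w`. -/
noncomputable def wordExp {Δ : Type*} (w : List Δ) : ℚ :=
  (w.length : ℚ) / (leastPeriodLength w : ℚ)

/-- The factor `a[i..i+n-1]` of length `n` of the infinite word `a`, beginning at position `i`. -/
def seqFactor {Δ : Type*} (a : ℕ → Δ) (i n : ℕ) : List Δ :=
  List.ofFn (fun j : Fin n => a (i + j))

/-- The finite word `w` occurs at infinitely many positions of `a`. -/
def OccursInfinitelyOften {Δ : Type*} (w : List Δ) (a : ℕ → Δ) : Prop :=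
  {i : ℕ | seqFactor a i w.length = w}.Infinite

/-- The supremum, in the extended reals, of the exponents of the nonempty finite factors of `a`
that occur infinitely often. -/
noncomputable def criticalExponentInf {Δ : Type*} (a : ℕ → Δ) : EReal :=
  sSup {e : EReal | ∃ w : List Δ, w ≠ [] ∧ OccursInfinitelyOften w a ∧
    e = (((wordExp w : ℚ) : ℝ) : EReal)}

/-! Automata with output and automatic sequences -/

/-- A deterministic automaton with output: input alphabet `{0, …, k-1}`, states `σ`, output
alphabet `Δ`. -/
structure DFAO (k : ℕ) (σ Δ : Type*) where
  step : σ → Fin k → σ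
  start : σ
  output : σ → Δ

/-- The base-`k` representation of `n`, most significant digit first and without leading zeros
(the empty word for `n = 0`). -/
def canonicalEncoding (k : ℕ) (hk : 2 ≤ k) (n : ℕ) : List (Fin k) :=
  (Nat.digits k n).reverse.pmap (fun d h => (⟨d, h⟩ : Fin k))
    (fun _ hd => Nat.digits_lt_base hk (List.mem_reverse.1 hd))

/-- The sequence generated by an automaton: term `n` is the output of the state reached on
reading the base-`k` representation of `n`. -/
def DFAO.sequence {k : ℕ} {σ Δ : Type*} (M : DFAO k σ Δ) (hk : 2 ≤ k) (n : ℕ) : Δ :=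
  M.output ((canonicalEncoding k hk n).foldl M.step M.start)

/-- `a` is `k`-automatic: `k ≥ 2` and `a` is generated by some finite automaton with output. -/
def IsAutomatic {Δ : Type*} (k : ℕ) (a : ℕ → Δ) : Prop :=
  ∃ hk : 2 ≤ k, ∃ (σ : Type) (_ : Finite σ) (M : DFAO k σ Δ), ∀ n, a n = M.sequence hk n

/-! Automata as inputs of an algorithm -/

/-- Finite descriptions of automata: the base, the start state, and for each state its list of
successors together with its output. -/
abbrev DFAOCode : Type := ℕ × ℕ × List (List ℕ × ℕ)

/-- The description of an automaton with states `0, …, m-1` and output symbols named by natural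
numbers. -/
def DFAO.code {k m : ℕ} (M : DFAO k (Fin m) ℕ) : DFAOCode :=
  (k, (M.start : ℕ), List.ofFn fun s : Fin m =>
    (List.ofFn fun d : Fin k => (M.step s d : ℕ), M.output s))

/-- What an output of the algorithm says about an extended real `c`: `none` says that `c = ∞`,
and `some (p, q)` says that `c` is the rational number `p / q`, where `q > 0`. -/
def IsExactValue (c : EReal) : Option (ℕ × ℕ) → Prop
  | none => c = ⊤
  | some (p, q) => 0 < q ∧ c = ((((p : ℚ) / (q : ℚ) : ℚ) : ℝ) : EReal)

open Filter

/-! Periods of words -/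

/-! A factor of length `l + p` with period `p` contributes `l / p + 1`, so the critical exponent
minus one is the supremum of `l / p` over the pairs in `RepInf a` (`criticalExponentInf_le_iff`).
This set of pairs is recognised by finitely many classes when the digits of `l` and `p` are read in
parallel: all that matters of the leading digits `L`, `P` is whether `P` is zero and which window
profiles occur infinitely often (`isDigitCongr_repInf`).

For such a set the supremum is found by pumping (`IsDigitCongr.exists_ratio_ge`). A long pair
contains a block of leading digits that may be removed or repeated. Repetition adds growing
multiples of a fixed vector `(A, E)`, so the ratios tend to `A / E`, while `l / p` is a mediant of
the shortened pair and a multiple of `(A, E)`. Hence `A / E` or the ratio of the shortened pair is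
at least `l / p`, and induction applies. The supremum is therefore infinite or the maximum of
finitely many ratios of bounded numbers (`IsDigitCongr.isRatioBound_iff`).

Whether some ratio exceeds `x / y` is settled by a bounded search (`not_isRatioBound_iff`): the
comparison is tracked by finitely many further classes, so a small pair exists if any does, and for
a fixed pair one position in a bounded range witnesses infinitely many (`frequently_repAt_iff`). One
such test detects an infinite value; a finite one has a denominator dividing a known factorial, and
finitely many tests then determine it. -/

theorem IsWordPeriod.getElem?_eq {Δ : Type*} {x w : List Δ} (h : IsWordPeriod x w) {j : ℕ}
    (hj : j + x.length < w.length) : w[j]? = w[j + x.length]? := by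
  obtain ⟨-, n, hn, x', hx', rfl⟩ := h
  obtain ⟨n, rfl⟩ : ∃ m, n = m + 1 := ⟨n - 1, by omega⟩
  set w' := (List.replicate n x).flatten ++ x' with hw'
  have h1 : (List.replicate (n + 1) x).flatten ++ x' = x ++ w' := by
    simp [List.replicate_succ, hw']
  -- With `x = x' y`, the whole word is `x ^ n x' y x'`, so deleting its first block leaves a prefix
  -- of it.
  have h2 : w' <+: (List.replicate (n + 1) x).flatten ++ x' := by
    obtain ⟨y, hy⟩ := hx'
    refine ⟨y ++ x', ?_⟩
    rw [List.replicate_succ', List.flatten_append]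
    simp only [hw', List.flatten_singleton, List.append_assoc, ← List.append_assoc x' y, hy]
  have h3 : ((List.replicate (n + 1) x).flatten ++ x')[j + x.length]? = w'[j]? := by
    rw [h1, List.getElem?_append_right (by omega)]
    simp
  rw [h3]
  have hj' : j < w'.length := by
    rw [h1, List.length_append] at hj
    omega
  obtain ⟨z, hz⟩ := h2
  rw [← hz, List.getElem?_append_left hj']

/-- Equality at distance `p` makes `w.drop p` a prefix of `w`, hence it begins with the same block
as `w` when it is long enough; blocks are split off by induction on the length. -/
theorem isWordPeriod_take {Δ : Type*} {p : ℕ} (hp : 1 ≤ p) (w : List Δ) (hw : p ≤ w.length)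
    (h : ∀ j, j + p < w.length → w[j]? = w[j + p]?) : IsWordPeriod (w.take p) w := by
  induction hn : w.length using Nat.strong_induction_on generalizing w with
  | _ n ih =>
    subst hn
    have hne : w.take p ≠ [] := by
      intro h0
      have := congrArg List.length h0
      simp at this
      rcases this with h | h
      · omega
      · simp [h] at hw; omega
    have hpre : w.drop p <+: w := by
      rw [List.prefix_iff_getElem?]
      intro i hi
      simp only [List.length_drop] at hi
      rw [h i (by omega), List.getElem_drop, List.getElem?_eq_getElem (by omega)]
      simp [Nat.add_comm]
    by_cases hl : (w.drop p).length < p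
    · refine ⟨hne, 1, le_rfl, w.drop p, ?_, by simp⟩
      exact List.prefix_of_prefix_length_le hpre (List.take_prefix p w)
        (by rw [List.length_take]; omega)
    · push Not at hl
      have hl' := hl
      simp only [List.length_drop] at hl'
      obtain ⟨-, n, hn, x', hx', he⟩ := ih (w.drop p).length (by simp; omega) (w.drop p) hl
        (fun j hj => by
          simp only [List.length_drop] at hj
          rw [List.getElem?_drop, List.getElem?_drop, h (p + j) (by omega),
            Nat.add_assoc]) rfl
      have ht : (w.drop p).take p = w.take p := by
        have h1 := List.prefix_of_prefix_length_le ((List.take_prefix p _).trans hpre)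
          (List.take_prefix p w) (by simp)
        exact h1.eq_of_length (by simp; omega)
      rw [ht] at hx' he
      refine ⟨hne, n + 1, by omega, x', hx', ?_⟩
      rw [List.replicate_succ, List.flatten_cons, List.append_assoc, ← he]
      simp

theorem leastPeriodLength_le {Δ : Type*} {p : ℕ} (hp : 1 ≤ p) {w : List Δ} (hw : p ≤ w.length)
    (h : ∀ j, j + p < w.length → w[j]? = w[j + p]?) : leastPeriodLength w ≤ p :=
  Nat.sInf_le ⟨_, isWordPeriod_take hp w hw h, by simp [hw]⟩

theorem exists_isWordPeriod_leastPeriodLength {Δ : Type*} {w : List Δ} (hw : w ≠ []) :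
    ∃ x, IsWordPeriod x w ∧ x.length = leastPeriodLength w :=
  Nat.sInf_mem (s := {p : ℕ | ∃ x : List Δ, IsWordPeriod x w ∧ x.length = p})
    ⟨w.length, w, ⟨hw, 1, le_rfl, [], by simp, by simp⟩, rfl⟩

theorem IsWordPeriod.length_pos {Δ : Type*} {x w : List Δ} (h : IsWordPeriod x w) :
    1 ≤ x.length :=
  List.length_pos_iff.2 h.1

theorem IsWordPeriod.length_le {Δ : Type*} {x w : List Δ} (h : IsWordPeriod x w) :
    x.length ≤ w.length := by
  obtain ⟨-, n, hn, x', -, rfl⟩ := h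
  simp only [List.length_append, List.length_flatten, List.map_replicate, List.sum_replicate,
    smul_eq_mul]
  nlinarith

/-! Repetitions in sequences -/

/-- The factor of length `l + p` of `a` at position `i` has period `p`. -/
def RepAt {Δ : Type*} (a : ℕ → Δ) (i l p : ℕ) : Prop :=
  ∀ j, i ≤ j → j < i + l → a j = a (j + p)

/-- At infinitely many positions there is a factor of `a` of length `l + p` with period `p`. -/
def RepInf {Δ : Type*} (a : ℕ → Δ) (l p : ℕ) : Prop :=
  1 ≤ p ∧ ∃ᶠ i in atTop, RepAt a i l p

/-- The ratio `x / y` is an upper bound of the ratios `l / p` for `(l, p)` in `S`. -/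
def IsRatioBound (S : ℕ → ℕ → Prop) (x y : ℕ) : Prop :=
  ∀ l p, S l p → l * y ≤ x * p

theorem length_seqFactor {Δ : Type*} (a : ℕ → Δ) (i n : ℕ) : (seqFactor a i n).length = n := by
  simp [seqFactor]

theorem getElem?_seqFactor {Δ : Type*} (a : ℕ → Δ) (i : ℕ) {n j : ℕ} (hj : j < n) :
    (seqFactor a i n)[j]? = some (a (i + j)) := by
  simp [seqFactor, hj]

theorem repAt_iff_seqFactor {Δ : Type*} (a : ℕ → Δ) (i l p : ℕ) :
    RepAt a i l p ↔ ∀ j, j + p < (seqFactor a i (l + p)).length →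
      (seqFactor a i (l + p))[j]? = (seqFactor a i (l + p))[j + p]? := by
  simp only [length_seqFactor]
  constructor
  · intro h j hj
    rw [getElem?_seqFactor a i (by omega), getElem?_seqFactor a i (by omega),
      h (i + j) (by omega) (by omega), Nat.add_assoc]
  · intro h j h1 h2
    obtain ⟨j, rfl⟩ := Nat.exists_eq_add_of_le h1
    have := h j (by omega)
    rw [getElem?_seqFactor a i (by omega), getElem?_seqFactor a i (by omega)] at this
    rw [Nat.add_assoc]
    exact Option.some.inj this

/-- Pigeonhole on windows of states: there are finitely many of length `l + p`, so one recurs at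
infinitely many of the positions. States are used because `Δ` need not be finite here. -/
theorem RepInf.exists_word {Δ Q : Type*} [Finite Q] {a : ℕ → Δ} {s : ℕ → Q} {o : Q → Δ}
    (ha : ∀ n, a n = o (s n)) {l p : ℕ} (h : RepInf a l p) :
    ∃ w : List Δ, w.length = l + p ∧ OccursInfinitelyOften w a ∧
      ∀ j, j + p < w.length → w[j]? = w[j + p]? := by
  obtain ⟨v, hv⟩ := Filter.frequently_exists
    (p := fun (v : Fin (l + p) → Q) i => RepAt a i l p ∧ v = fun j : Fin (l + p) => s (i + j)) |>.1
    (h.2.mono fun i hi => ⟨_, hi, rfl⟩)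
  have key : ∀ i, (v = fun j : Fin (l + p) => s (i + j)) →
      seqFactor a i (l + p) = List.ofFn fun j => o (v j) := by
    rintro i rfl
    simp [seqFactor, ha]
  refine ⟨List.ofFn fun j => o (v j), by simp, ?_, ?_⟩
  · refine (Nat.frequently_atTop_iff_infinite.1 hv).mono ?_
    rintro i ⟨-, hi⟩
    simpa using key i hi
  · obtain ⟨i, hi, hvi⟩ := hv.exists
    rw [← key i hvi]
    exact (repAt_iff_seqFactor a i l p).1 hi

theorem OccursInfinitelyOften.repInf {Δ : Type*} {a : ℕ → Δ} {x w : List Δ}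
    (h : OccursInfinitelyOften w a) (hx : IsWordPeriod x w) :
    RepInf a (w.length - x.length) x.length := by
  refine ⟨hx.length_pos, Nat.frequently_atTop_iff_infinite.2 (h.mono ?_)⟩
  intro i hi
  simp only [Set.mem_ofPred_eq] at hi ⊢
  rw [repAt_iff_seqFactor, Nat.sub_add_cancel hx.length_le, hi]
  exact fun j hj => hx.getElem?_eq hj

/-- A period that is not the least only underestimates the exponent, so allowing all periods in
`RepInf` does not change the upper bounds. -/
theorem criticalExponentInf_le_iff {Δ Q : Type*} [Finite Q] {a : ℕ → Δ} {s : ℕ → Q} {o : Q → Δ}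
    (ha : ∀ n, a n = o (s n)) (x : ℕ) {y : ℕ} (hy : 1 ≤ y) :
    criticalExponentInf a ≤ ((((x : ℚ) / (y : ℚ) + 1 : ℚ) : ℝ) : EReal) ↔
      IsRatioBound (RepInf a) x y := by
  have hy' : (0 : ℚ) < y := by exact_mod_cast hy
  constructor
  · intro h l p hlp
    obtain ⟨w, hw, ho, hp⟩ := hlp.exists_word ha
    have hp1 := hlp.1
    have hne : w ≠ [] := by
      rintro rfl
      simp at hw
      omega
    have h1 := (le_sSup ⟨w, hne, ho, rfl⟩ : _ ≤ criticalExponentInf a).trans h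
    rw [EReal.coe_le_coe_iff, Rat.cast_le] at h1
    have h2 := leastPeriodLength_le hp1 (by omega) hp
    obtain ⟨u, hu, hul⟩ := exists_isWordPeriod_leastPeriodLength hne
    have h3 := hu.length_pos
    rw [hul] at h3
    have h4 : (0 : ℚ) < leastPeriodLength w := by exact_mod_cast h3
    have h5 : (leastPeriodLength w : ℚ) ≤ p := by exact_mod_cast h2
    have h6 : ((l : ℚ) + p) / p ≤ (x : ℚ) / y + 1 := by
      refine le_trans ?_ h1
      unfold wordExp
      rw [hw]
      push_cast
      gcongr
    have hp0 : (0 : ℚ) < p := lt_of_lt_of_le h4 h5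
    rw [add_div, div_self hp0.ne', add_le_add_iff_right, div_le_div_iff₀ hp0 hy'] at h6
    exact_mod_cast h6
  · intro h
    refine sSup_le ?_
    rintro _ ⟨w, hne, ho, rfl⟩
    rw [EReal.coe_le_coe_iff, Rat.cast_le]
    obtain ⟨u, hu, hul⟩ := exists_isWordPeriod_leastPeriodLength hne
    have h1 := h _ _ (ho.repInf hu)
    have h3 : (0 : ℚ) < u.length := by exact_mod_cast hu.length_pos
    unfold wordExp
    rw [← hul]
    have h2 : (w.length : ℚ) = ((w.length - u.length : ℕ) : ℚ) + u.length := by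
      rw [Nat.cast_sub hu.length_le]; ring
    rw [h2, add_div, div_self h3.ne', add_le_add_iff_right, div_le_div_iff₀ h3 hy']
    exact_mod_cast h1

theorem repInf_zero_one {Δ : Type*} (a : ℕ → Δ) : RepInf a 0 1 :=
  ⟨le_rfl, Frequently.of_forall fun i j h1 h2 => by omega⟩

/-- Covers the values below `1`, which the bounds `x / y + 1` with natural `x` cannot reach. -/
theorem one_le_criticalExponentInf {Δ Q : Type*} [Finite Q] {a : ℕ → Δ} {s : ℕ → Q} {o : Q → Δ}
    (ha : ∀ n, a n = o (s n)) : 1 ≤ criticalExponentInf a := by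
  obtain ⟨w, hw, ho, -⟩ := (repInf_zero_one a).exists_word ha
  have hne : w ≠ [] := by
    rintro rfl
    simp at hw
  refine le_trans ?_ (le_sSup ⟨w, hne, ho, rfl⟩ : _ ≤ criticalExponentInf a)
  obtain ⟨u, hu, hul⟩ := exists_isWordPeriod_leastPeriodLength hne
  have h1 : (0 : ℚ) < u.length := by exact_mod_cast hu.length_pos
  have h2 : (u.length : ℚ) ≤ w.length := by exact_mod_cast hu.length_le
  have h3 : (1 : ℚ) ≤ wordExp w := by
    unfold wordExp
    rwa [← hul, one_le_div h1]
  rw [← EReal.coe_one, EReal.coe_le_coe_iff]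
  exact_mod_cast h3

/-! Sets of pairs of numbers recognised by finitely many classes -/

/-- If two pairs of numbers have the same class, then appending the same base-`k` digits to both
gives pairs of which both or none belong to `S`. -/
def IsDigitCongr {C : Type*} (k : ℕ) (S : ℕ → ℕ → Prop) (c : ℕ → ℕ → C) : Prop :=
  ∀ L P L' P', c L P = c L' P' → ∀ t u v, u < k ^ t → v < k ^ t →
    S (L * k ^ t + u) (P * k ^ t + v) → S (L' * k ^ t + u) (P' * k ^ t + v)

theorem exists_lt_eq_of_card_le {C : Type*} [Finite C] {N : ℕ} (hN : Nat.card C ≤ N) (g : ℕ → C) :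
    ∃ i j, i < j ∧ j ≤ N ∧ g i = g j := by
  have := Fintype.ofFinite C
  obtain ⟨i, j, hij, h⟩ := Fintype.exists_ne_map_eq_of_card_lt (fun i : Fin (N + 1) => g i)
    (by rw [← Nat.card_eq_fintype_card]; simpa using Nat.lt_succ_of_le hN)
  rcases lt_or_gt_of_ne (Fin.val_ne_of_ne hij) with h1 | h1
  · exact ⟨i, j, h1, by omega, h⟩
  · exact ⟨j, i, h1, by omega, h.symm⟩

theorem div_pow_mul_le {k n t d : ℕ} : n / k ^ (t + d) * k ^ d ≤ n / k ^ t := by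
  rw [pow_add, ← Nat.div_div_eq_div_mul]
  exact Nat.div_mul_le_self _ _

theorem two_mul_div_pow_le {k n t d : ℕ} (hk : 2 ≤ k) (hd : 1 ≤ d) :
    2 * (n / k ^ (t + d)) ≤ n / k ^ t := by
  refine le_trans ?_ (div_pow_mul_le (d := d))
  rw [mul_comm]
  refine Nat.mul_le_mul_left _ (hk.trans ?_)
  simpa using Nat.pow_le_pow_right (by omega : 0 < k) hd

/-- A nonempty set with `N` classes contains a pair of numbers with at most `N` digits. -/
theorem IsDigitCongr.exists_lt_pow {C : Type*} [Finite C] {k : ℕ} (hk : 2 ≤ k)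
    {S : ℕ → ℕ → Prop} {c : ℕ → ℕ → C} (h : IsDigitCongr k S c) {N : ℕ} (hN : Nat.card C ≤ N)
    {l p : ℕ} (hS : S l p) : ∃ l' p', l' < k ^ N ∧ p' < k ^ N ∧ S l' p' := by
  induction hn : l + p using Nat.strong_induction_on generalizing l p with
  | _ n ih =>
    by_cases hsmall : l < k ^ N ∧ p < k ^ N
    · exact ⟨l, p, hsmall.1, hsmall.2, hS⟩
    -- Two of the truncations by `0, …, N` digits share a class; cutting out the digits between them
    -- stays in `S` and gives a smaller pair.
    obtain ⟨i, j, hij, hj, he⟩ := exists_lt_eq_of_card_le hN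
      (fun t => c (l / k ^ t) (p / k ^ t))
    have hpos : 0 < k ^ i := by positivity
    have h1 := h _ _ _ _ he i (l % k ^ i) (p % k ^ i) (Nat.mod_lt _ hpos) (Nat.mod_lt _ hpos)
    rw [Nat.div_add_mod', Nat.div_add_mod'] at h1
    refine ih _ ?_ (h1 hS) rfl
    obtain ⟨d, rfl⟩ := Nat.exists_eq_add_of_lt hij
    rw [add_assoc] at *
    have hl := two_mul_div_pow_le (n := l) (t := i) hk (Nat.le_add_left 1 d)
    have hp := two_mul_div_pow_le (n := p) (t := i) hk (Nat.le_add_left 1 d)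
    have hki : k ^ i ≤ k ^ N := Nat.pow_le_pow_right (by omega) (by omega)
    have h3 : 1 ≤ l / k ^ i + p / k ^ i := by
      by_contra hc
      have h4 : l / k ^ i = 0 := by omega
      have h5 : p / k ^ i = 0 := by omega
      rw [Nat.div_eq_zero_iff_lt hpos] at h4 h5
      exact hsmall ⟨by omega, by omega⟩
    have h6 : l / k ^ (i + (d + 1)) + p / k ^ (i + (d + 1)) < l / k ^ i + p / k ^ i := by omega
    have h7 := Nat.mul_lt_mul_of_pos_right h6 hpos
    have h8 := Nat.div_add_mod' l (k ^ i)
    have h9 := Nat.div_add_mod' p (k ^ i)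
    rw [add_mul, add_mul] at h7
    rw [add_assoc i d 1]
    omega

/-- `pumpGap K n` is the number `1 + K + ⋯ + K ^ (n - 1)`. -/
def pumpGap (K : ℕ) : ℕ → ℕ
  | 0 => 0
  | n + 1 => pumpGap K n * K + 1

theorem le_pumpGap {K : ℕ} (hK : 1 ≤ K) (n : ℕ) : n ≤ pumpGap K n := by
  induction n with
  | zero => simp
  | succ n ih =>
    simp only [pumpGap]
    nlinarith

/-- Repeating a digit block that does not change the class keeps the pair in `S`. -/
theorem IsDigitCongr.pump {C : Type*} {k : ℕ}
    {S : ℕ → ℕ → Prop} {c : ℕ → ℕ → C} (h : IsDigitCongr k S c) {L P A E d : ℕ}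
    (hA : L * k ^ d ≤ L + A) (hA' : L + A < L * k ^ d + k ^ d)
    (hE : P * k ^ d ≤ P + E) (hE' : P + E < P * k ^ d + k ^ d)
    (he : c L P = c (L + A) (P + E)) (n t u v : ℕ) (hu : u < k ^ t) (hv : v < k ^ t) :
    S ((L + pumpGap (k ^ d) n * A) * k ^ t + u) ((P + pumpGap (k ^ d) n * E) * k ^ t + v) ↔
      S (L * k ^ t + u) (P * k ^ t + v) := by
  induction n generalizing t u v with
  | zero => simp [pumpGap]
  | succ n ih =>
    -- The hypotheses say that `L + A` and `P + E` are `L` and `P` followed by `d` digits, which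
    -- form `x` and `y`. The last copy of this block is moved to the appended digits, where `ih`
    -- applies.
    obtain ⟨x, hx⟩ := Nat.exists_eq_add_of_le hA
    obtain ⟨y, hy⟩ := Nat.exists_eq_add_of_le hE
    have hx' : x < k ^ d := by omega
    have hy' : y < k ^ d := by omega
    have bound : ∀ {x u : ℕ}, x < k ^ d → u < k ^ t → x * k ^ t + u < k ^ (d + t) := by
      intro x u hx hu
      rw [pow_add]
      nlinarith
    have e1 : (L + pumpGap (k ^ d) (n + 1) * A) * k ^ t + u =
        (L + pumpGap (k ^ d) n * A) * k ^ (d + t) + (x * k ^ t + u) := by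
      have : L + pumpGap (k ^ d) (n + 1) * A = (L + pumpGap (k ^ d) n * A) * k ^ d + x := by
        simp only [pumpGap]
        linear_combination hx
      rw [this, pow_add]; ring
    have e2 : (P + pumpGap (k ^ d) (n + 1) * E) * k ^ t + v =
        (P + pumpGap (k ^ d) n * E) * k ^ (d + t) + (y * k ^ t + v) := by
      have : P + pumpGap (k ^ d) (n + 1) * E = (P + pumpGap (k ^ d) n * E) * k ^ d + y := by
        simp only [pumpGap]
        linear_combination hy
      rw [this, pow_add]; ring
    rw [e1, e2, ih (d + t) _ _ (bound hx' hu) (bound hy' hv)]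
    have e3 : L * k ^ (d + t) + (x * k ^ t + u) = (L + A) * k ^ t + u := by
      rw [hx, pow_add]; ring
    have e4 : P * k ^ (d + t) + (y * k ^ t + v) = (P + E) * k ^ t + v := by
      rw [hy, pow_add]; ring
    rw [e3, e4]
    exact ⟨h _ _ _ _ he.symm t u v hu hv, h _ _ _ _ he t u v hu hv⟩

/-- Every ratio in a set with `N` classes is bounded by a ratio `A / E` of numbers with at most `N`
digits that is itself a limit of ratios of the set. -/
theorem IsDigitCongr.exists_ratio_ge {C : Type*} [Finite C] {k : ℕ} (hk : 2 ≤ k)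
    {S : ℕ → ℕ → Prop} {c : ℕ → ℕ → C} (h : IsDigitCongr k S c) {N : ℕ} (hN : Nat.card C ≤ N)
    (hpos : ∀ l p, S l p → 1 ≤ p) {l p : ℕ} (hS : S l p) :
    ∃ A E, A < k ^ N ∧ E < k ^ N ∧ (A ≠ 0 ∨ E ≠ 0) ∧ l * E ≤ A * p ∧
      ∀ x y, IsRatioBound S x y → A * y ≤ x * E := by
  induction hn : l + p using Nat.strong_induction_on generalizing l p with
  | _ n ih =>
    have hp := hpos _ _ hS
    by_cases hsmall : l < k ^ N ∧ p < k ^ N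
    · exact ⟨l, p, hsmall.1, hsmall.2, Or.inr (by omega), le_rfl, fun x y hxy => hxy _ _ hS⟩
    have hex : ∃ T, l < k ^ T ∧ p < k ^ T := by
      refine ⟨l + p, ?_, ?_⟩
      · exact (Nat.lt_pow_self (by omega)).trans_le (Nat.pow_le_pow_right (by omega) (by omega))
      · exact (Nat.lt_pow_self (by omega)).trans_le (Nat.pow_le_pow_right (by omega) (by omega))
    classical
    obtain ⟨T, hT, hTmin⟩ : ∃ T, (l < k ^ T ∧ p < k ^ T) ∧ ∀ T' < T, ¬(l < k ^ T' ∧ p < k ^ T') :=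
      ⟨Nat.find hex, Nat.find_spec hex, fun _ => Nat.find_min hex⟩
    have hNT : N < T := by
      by_contra hc
      have : k ^ T ≤ k ^ N := Nat.pow_le_pow_right (by omega) (by omega)
      exact hsmall ⟨by omega, by omega⟩
    -- Only the leading `N` of the `T` digits are searched for a repeated class; this keeps `A` and
    -- `E` below `k ^ N`.
    obtain ⟨i, j, hij, hj, he⟩ := exists_lt_eq_of_card_le hN
      (fun t => c (l / k ^ (T - N + t)) (p / k ^ (T - N + t)))
    obtain ⟨d, rfl⟩ := Nat.exists_eq_add_of_lt hij
    set t := T - N + i with ht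
    simp only [← add_assoc] at he
    rw [← ht, add_assoc t d 1] at he
    set D := d + 1 with hD
    have hkt : 0 < k ^ t := by positivity
    have hkD : 0 < k ^ D := by positivity
    have facts : ∀ n, n < k ^ T → ∃ A, n / k ^ t = n / k ^ (t + D) + A ∧
        n / k ^ (t + D) * k ^ D ≤ n / k ^ (t + D) + A ∧
        n / k ^ (t + D) + A < n / k ^ (t + D) * k ^ D + k ^ D ∧ A < k ^ N ∧
        (n / k ^ t ≠ 0 → A ≠ 0) := by
      intro n hn
      have h1 := two_mul_div_pow_le (n := n) (t := t) hk (by omega : 1 ≤ D)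
      have h2 : n / k ^ t = n / k ^ (t + D) + (n / k ^ t - n / k ^ (t + D)) := by omega
      refine ⟨n / k ^ t - n / k ^ (t + D), h2, ?_, ?_, ?_, by omega⟩
      · rw [← h2]; exact div_pow_mul_le
      · rw [← h2, pow_add k t D, ← Nat.div_div_eq_div_mul]
        exact Nat.lt_div_mul_add hkD
      · refine (Nat.sub_le _ _).trans_lt ?_
        rw [Nat.div_lt_iff_lt_mul hkt, ← pow_add]
        exact hn.trans_le (Nat.pow_le_pow_right (by omega) (by omega))
    obtain ⟨A, hA1, hA2, hA3, hA4, hA5⟩ := facts l hT.1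
    obtain ⟨E, hE1, hE2, hE3, hE4, hE5⟩ := facts p hT.2
    have hne : A ≠ 0 ∨ E ≠ 0 := by
      by_contra hc
      push Not at hc
      have h4 : l / k ^ t = 0 := by by_contra h; exact hA5 h hc.1
      have h5 : p / k ^ t = 0 := by by_contra h; exact hE5 h hc.2
      rw [Nat.div_eq_zero_iff_lt hkt] at h4 h5
      exact hTmin t (by omega) ⟨h4, h5⟩
    rw [hA1, hE1] at he
    have hl := Nat.div_add_mod' l (k ^ t)
    have hp' := Nat.div_add_mod' p (k ^ t)
    rw [hA1] at hl
    rw [hE1] at hp'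
    have hpump := fun n => h.pump hA2 hA3 hE2 hE3 he.symm n t _ _
      (Nat.mod_lt l hkt) (Nat.mod_lt p hkt)
    generalize l / k ^ (t + D) = L at *
    generalize p / k ^ (t + D) = P at *
    generalize l % k ^ t = u at *
    generalize p % k ^ t = v at *
    -- The given pair is the shortened pair pumped once, since `pumpGap _ 1 = 1`.
    have h0 : S (L * k ^ t + u) (P * k ^ t + v) := by
      rw [← hpump 1]
      simpa [pumpGap, hl, hp'] using hS
    have hlim : ∀ x y, IsRatioBound S x y → A * y ≤ x * E := by
      intro x y hxy
      by_contra hc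
      push Not at hc
      -- If `A * y` exceeded `x * E`, each unit of the gap would gain at least one, so this many
      -- outweigh the fixed term `x * (P * k ^ t + v)`.
      set n := x * (P * k ^ t + v) + 1
      have h1 := hxy _ _ ((hpump n).2 h0)
      have h2 := le_pumpGap hkD n
      generalize pumpGap (k ^ D) n = G at *
      have h3 : (L + G * A) * k ^ t + u = L * k ^ t + u + G * k ^ t * A := by ring
      have h4 : (P + G * E) * k ^ t + v = P * k ^ t + v + G * k ^ t * E := by ring
      rw [h3, h4] at h1
      have h5 : G ≤ G * k ^ t := Nat.le_mul_of_pos_right _ hkt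
      have h6 : G * k ^ t * (x * E + 1) ≤ G * k ^ t * (A * y) := Nat.mul_le_mul_left _ hc
      have h7 : G * k ^ t * (A * y) ≤ (L * k ^ t + u + G * k ^ t * A) * y := by
        have : G * k ^ t * (A * y) = (G * k ^ t * A) * y := by ring
        rw [this]
        exact Nat.mul_le_mul_right _ (Nat.le_add_left _ _)
      have h8 : x * (P * k ^ t + v + G * k ^ t * E) =
        x * (P * k ^ t + v) + G * k ^ t * (x * E) := by ring
      rw [h8] at h1
      rw [mul_add] at h6
      omega
    -- Mediant argument: if `l / p` exceeds `A / E`, then `A / E` is at most the ratio of the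
    -- shortened pair, and a bound for the latter from `ih` also bounds `l / p`.
    by_cases hcmp : l * E ≤ A * p
    · exact ⟨A, E, hA4, hE4, hne, hcmp, hlim⟩
    push Not at hcmp
    have hsum : L * k ^ t + u + (P * k ^ t + v) < n := by
      have h1 : 1 ≤ A + E := by omega
      have h2 : 1 ≤ (A + E) * k ^ t := Nat.mul_pos h1 hkt
      rw [← hn, ← hl, ← hp']
      nlinarith
    obtain ⟨A', E', h1, h2, h3, h4, h5⟩ := ih _ hsum h0 rfl
    refine ⟨A', E', h1, h2, h3, ?_, h5⟩
    have hp0 := hpos _ _ h0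
    have el : l = (L * k ^ t + u) + A * k ^ t := by rw [← hl]; ring
    have ep : p = (P * k ^ t + v) + E * k ^ t := by rw [← hp']; ring
    generalize L * k ^ t + u = l₀ at *
    generalize P * k ^ t + v = p₀ at *
    have h6 : A * p₀ ≤ l₀ * E := by
      have : A * (p₀ + E * k ^ t) < (l₀ + A * k ^ t) * E := by rw [← el, ← ep]; exact hcmp
      have e1 : A * (p₀ + E * k ^ t) = A * p₀ + A * E * k ^ t := by ring
      have e2 : (l₀ + A * k ^ t) * E = l₀ * E + A * E * k ^ t := by ring
      omega
    have h7 : A * E' ≤ A' * E := by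
      refine Nat.le_of_mul_le_mul_right (c := p₀) ?_ hp0
      calc A * E' * p₀ = A * p₀ * E' := by ring
        _ ≤ l₀ * E * E' := Nat.mul_le_mul_right _ h6
        _ = l₀ * E' * E := by ring
        _ ≤ A' * p₀ * E := Nat.mul_le_mul_right _ h4
        _ = A' * E * p₀ := by ring
    rw [el, ep]
    calc (l₀ + A * k ^ t) * E' = l₀ * E' + A * E' * k ^ t := by ring
      _ ≤ A' * p₀ + A' * E * k ^ t := add_le_add h4 (Nat.mul_le_mul_right _ h7)
      _ = A' * (p₀ + E * k ^ t) := by ring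

/-- The supremum of the ratios of a set with `N` classes is infinite, or it is a ratio of numbers
with at most `N` digits. -/
theorem IsDigitCongr.isRatioBound_iff {C : Type*} [Finite C] {k : ℕ} (hk : 2 ≤ k)
    {S : ℕ → ℕ → Prop} {c : ℕ → ℕ → C} (h : IsDigitCongr k S c) {N : ℕ} (hN : Nat.card C ≤ N)
    (hpos : ∀ l p, S l p → 1 ≤ p) (hne : ∃ l p, S l p) :
    (∀ x y, 1 ≤ y → ¬ IsRatioBound S x y) ∨
      ∃ A E, A < k ^ N ∧ 1 ≤ E ∧ E < k ^ N ∧ ∀ x y, IsRatioBound S x y ↔ A * y ≤ x * E := by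
  classical
  -- This is a limit ratio `A / 0`: the numerators can be pumped while the denominators stay fixed.
  by_cases hinf : ∃ A, A ≠ 0 ∧ ∀ x y, IsRatioBound S x y → A * y ≤ x * 0
  · left
    obtain ⟨A, hA, h0⟩ := hinf
    intro x y hy hxy
    have h1 := h0 x y hxy
    have : 1 ≤ A * y := Nat.mul_pos (Nat.pos_of_ne_zero hA) hy
    omega
  right
  push Not at hinf
  -- The candidate ratios that lie below every upper bound; by `key` they dominate `S`, so their
  -- maximum is the least upper bound.
  set F : Finset (ℕ × ℕ) := (Finset.range (k ^ N) ×ˢ Finset.range (k ^ N)).filter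
    fun q => 1 ≤ q.2 ∧ ∀ x y, IsRatioBound S x y → q.1 * y ≤ x * q.2 with hF
  have key : ∀ l p, S l p → ∃ q ∈ F, l * q.2 ≤ q.1 * p := by
    intro l p hS
    obtain ⟨A, E, h1, h2, h3, h4, h5⟩ := h.exists_ratio_ge hk hN hpos hS
    have hE : E ≠ 0 := by
      rintro rfl
      obtain ⟨x, y, h6, h7⟩ := hinf A (by simpa using h3)
      have := h5 x y h6
      omega
    refine ⟨(A, E), ?_, h4⟩
    simp only [hF, Finset.mem_filter, Finset.mem_product, Finset.mem_range]
    exact ⟨⟨h1, h2⟩, Nat.pos_of_ne_zero hE, h5⟩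
  obtain ⟨l₀, p₀, hS₀⟩ := hne
  obtain ⟨q₀, hq₀, -⟩ := key _ _ hS₀
  obtain ⟨⟨A, E⟩, hq, hmax⟩ := F.exists_max_image (fun q => (q.1 : ℚ) / q.2) ⟨q₀, hq₀⟩
  simp only [hF, Finset.mem_filter, Finset.mem_product, Finset.mem_range] at hq
  obtain ⟨⟨hA, hE⟩, hE1, hlim⟩ := hq
  refine ⟨A, E, hA, hE1, hE, fun x y => ⟨hlim x y, ?_⟩⟩
  intro hxy l p hS
  obtain ⟨⟨A', E'⟩, hq', h1⟩ := key l p hS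
  have h2 := hmax _ hq'
  simp only [hF, Finset.mem_filter, Finset.mem_product, Finset.mem_range] at hq' h1
  have hE'1 := hq'.2.1
  rw [div_le_div_iff₀ (by exact_mod_cast hE'1) (by exact_mod_cast hE1)] at h2
  have h3 : A' * E ≤ A * E' := by exact_mod_cast h2
  refine Nat.le_of_mul_le_mul_right (c := E' * E) ?_ (Nat.mul_pos hE'1 hE1)
  calc l * y * (E' * E) = l * E' * (y * E) := by ring
    _ ≤ A' * p * (y * E) := Nat.mul_le_mul_right _ h1
    _ = A' * E * (p * y) := by ring
    _ ≤ A * E' * (p * y) := Nat.mul_le_mul_right _ h3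
    _ = A * y * (p * E') := by ring
    _ ≤ x * E * (p * E') := Nat.mul_le_mul_right _ hxy
    _ = x * p * (E' * E) := by ring

/-! Sequences in which appended digits act on a finite set of states -/

/-- The value of `s` at `n * k + d` is determined by `d < k` and the value at `n ≥ 1`. -/
def IsDigitStable {Q : Type*} (k : ℕ) (s : ℕ → Q) : Prop :=
  ∀ X X' d, 1 ≤ X → 1 ≤ X' → d < k → s X = s X' → s (X * k + d) = s (X' * k + d)

theorem IsDigitStable.append {Q : Type*} {k : ℕ} {s : ℕ → Q} (h : IsDigitStable k s) (hk : 2 ≤ k)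
    {X X' : ℕ} (hX : 1 ≤ X) (hX' : 1 ≤ X') (he : s X = s X') {t u : ℕ} (hu : u < k ^ t) :
    s (X * k ^ t + u) = s (X' * k ^ t + u) := by
  induction t generalizing u with
  | zero =>
    obtain rfl : u = 0 := by simpa using hu
    simpa using he
  | succ t ih =>
    have h1 : u / k < k ^ t := by
      rw [Nat.div_lt_iff_lt_mul (by omega), ← pow_succ]
      exact hu
    have h2 : ∀ Y, Y * k ^ (t + 1) + u = (Y * k ^ t + u / k) * k + u % k := by
      intro Y
      have := Nat.div_add_mod' u k
      rw [pow_succ]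
      linear_combination -this
    have h3 : ∀ Y, 1 ≤ Y → 1 ≤ Y * k ^ t + u / k := fun Y hY =>
      (Nat.mul_pos hY (by positivity)).trans_le (Nat.le_add_right _ _)
    rw [h2, h2]
    exact h _ _ _ (h3 X hX) (h3 X' hX') (Nat.mod_lt _ (by omega)) (ih h1)

/-- Adding less than `2 * k ^ t` carries at most one into `X`, so the states at `X` and `X + 1`
suffice. -/
theorem IsDigitStable.append_carry {Q : Type*} {k : ℕ} {s : ℕ → Q} (h : IsDigitStable k s)
    (hk : 2 ≤ k) {X X' : ℕ} (hX : 1 ≤ X) (hX' : 1 ≤ X') (he : s X = s X')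
    (he1 : s (X + 1) = s (X' + 1)) {t u : ℕ} (hu : u < 2 * k ^ t) :
    s (X * k ^ t + u) = s (X' * k ^ t + u) := by
  by_cases hu1 : u < k ^ t
  · exact h.append hk hX hX' he hu1
  · obtain ⟨v, rfl⟩ := Nat.exists_eq_add_of_le (not_lt.1 hu1)
    have h2 : ∀ Y, Y * k ^ t + (k ^ t + v) = (Y + 1) * k ^ t + v := fun Y => by ring
    rw [h2, h2]
    exact h.append hk (by omega) (by omega) he1 (by omega)

/-- The states at and around the positions `X ≥ I`, the states at distance `P` from them, and the
situation of `X` relative to the window of length `L` at `I`. -/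
def windowProfile {Q : Type*} (s : ℕ → Q) (L P I : ℕ) :
    Set ((Prop × Prop × Prop × Prop) × Q × Q × Q) :=
  {e | ∃ X, I ≤ X ∧ e = ((X = I, X < I + L, X = I + L, X = I + L + 1),
    s X, s (X + P), s (X + P + 1))}

theorem mul_add_le_iff {K X I x w : ℕ} (hx : x < K) (hw : w < K) :
    I * K + w ≤ X * K + x ↔ I < X ∨ X = I ∧ w ≤ x := by
  rcases lt_trichotomy X I with h | rfl | h
  · obtain ⟨d, rfl⟩ := Nat.exists_eq_add_of_lt h
    have : (X + d + 1) * K = X * K + d * K + K := by ring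
    have := Nat.zero_le (d * K)
    constructor <;> intro <;> omega
  · omega
  · obtain ⟨d, rfl⟩ := Nat.exists_eq_add_of_lt h
    have : (I + d + 1) * K = I * K + d * K + K := by ring
    have := Nat.zero_le (d * K)
    constructor <;> intro <;> omega

/-- The end of a window has low part `w < 2 * K` because the low parts of its start and length are
added; the carry accounts for the case `X = E + 1`. -/
theorem mul_add_lt_iff {K X E x w : ℕ} (hx : x < K) (hw : w < 2 * K) :
    X * K + x < E * K + w ↔ X < E ∨ (X = E ∧ x < w) ∨ (X = E + 1 ∧ x + K < w) := by
  rcases lt_trichotomy X E with h | rfl | h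
  · obtain ⟨d, rfl⟩ := Nat.exists_eq_add_of_lt h
    have : (X + d + 1) * K = X * K + d * K + K := by ring
    have := Nat.zero_le (d * K)
    constructor <;> intro <;> omega
  · omega
  · obtain ⟨d, rfl⟩ := Nat.exists_eq_add_of_lt h
    have : (E + d + 1) * K = E * K + d * K + K := by ring
    rcases Nat.eq_zero_or_pos d with rfl | hd
    · omega
    · have := Nat.le_mul_of_pos_left K hd
      constructor <;> intro <;> omega

/-- Every position of the second window has a leading part whose profile entry also occurs for the
first window. The counterpart with the same low digits lies in the first window and carries the same
states, also at the shifted position. -/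
theorem RepAt.of_windowProfile_eq {Δ Q : Type*} {k : ℕ} {a : ℕ → Δ} {s : ℕ → Q} {o : Q → Δ}
    (ha : ∀ n, a n = o (s n)) (h : IsDigitStable k s) (hk : 2 ≤ k) {L P I L' P' I' : ℕ}
    (hI : 1 ≤ I) (hI' : 1 ≤ I') (he : windowProfile s L P I = windowProfile s L' P' I')
    {t u v w : ℕ} (hu : u < k ^ t) (hv : v < k ^ t) (hw : w < k ^ t)
    (hr : RepAt a (I * k ^ t + w) (L * k ^ t + u) (P * k ^ t + v)) :
    RepAt a (I' * k ^ t + w) (L' * k ^ t + u) (P' * k ^ t + v) := by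
  intro j h1 h2
  have hK : 0 < k ^ t := by positivity
  obtain ⟨X', x, hx, rfl⟩ : ∃ X' x, x < k ^ t ∧ j = X' * k ^ t + x :=
    ⟨j / k ^ t, j % k ^ t, Nat.mod_lt _ hK, (Nat.div_add_mod' _ _).symm⟩
  have e1 : ∀ I L, I * k ^ t + w + (L * k ^ t + u) = (I + L) * k ^ t + (w + u) :=
    fun I L => by ring
  have e2 : ∀ X P, X * k ^ t + x + (P * k ^ t + v) = (X + P) * k ^ t + (x + v) :=
    fun X P => by ring
  rw [mul_add_le_iff hx hw] at h1
  rw [e1, mul_add_lt_iff hx (by omega)] at h2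
  have hmem : ((X' = I', X' < I' + L', X' = I' + L', X' = I' + L' + 1),
      s X', s (X' + P'), s (X' + P' + 1)) ∈ windowProfile s L P I := by
    rw [he]
    exact ⟨X', by omega, rfl⟩
  obtain ⟨X, hX, hXe⟩ := hmem
  simp only [Prod.mk.injEq, eq_iff_iff] at hXe
  obtain ⟨⟨c1, c2, c3, c4⟩, s1, s2, s3⟩ := hXe
  have h3 := hr (X * k ^ t + x) ((mul_add_le_iff hx hw).2 (by omega))
    (by rw [e1, mul_add_lt_iff hx (by omega)]; rwa [c2, c3, c4] at h2)
  rw [e2, ha, ha] at h3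
  rw [e2, ha, ha, h.append hk (by omega) (by omega) s1 hx,
    h.append_carry hk (by omega) (by omega) s2 s3 (by omega), h3]

/-- The class of a pair of a length and a distance: the window profiles that occur infinitely
often, and whether the distance is zero. -/
def repClass {Q : Type*} (s : ℕ → Q) (L P : ℕ) :
    Prop × Set (Set ((Prop × Prop × Prop × Prop) × Q × Q × Q)) :=
  (P = 0, {τ | ∃ᶠ I in atTop, windowProfile s L P I = τ})

theorem isDigitCongr_repInf {Δ Q : Type*} [Finite Q] {k : ℕ} {a : ℕ → Δ} {s : ℕ → Q} {o : Q → Δ}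
    (ha : ∀ n, a n = o (s n)) (h : IsDigitStable k s) (hk : 2 ≤ k) :
    IsDigitCongr k (RepInf a) (repClass s) := by
  intro L P L' P' he t u v hu hv hS
  have hK : 0 < k ^ t := by positivity
  simp only [repClass, Prod.mk.injEq, eq_iff_iff] at he
  obtain ⟨he0, he⟩ := he
  refine ⟨?_, ?_⟩
  · have h1 := hS.1
    rcases Nat.eq_zero_or_pos P' with h0 | h0
    · rw [he0.2 h0, zero_mul] at h1
      omega
    · exact (Nat.mul_pos h0 hK).trans_le (Nat.le_add_right _ _)
  -- Positions are split as `I * k ^ t + w`; finitely many `w` and profiles allow one of each to be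
  -- fixed for infinitely many `I`.
  have h1 : ∃ᶠ I in atTop, ∃ (w : Fin (k ^ t))
      (τ : Set ((Prop × Prop × Prop × Prop) × Q × Q × Q)), 1 ≤ I ∧
      RepAt a (I * k ^ t + w) (L * k ^ t + u) (P * k ^ t + v) ∧ windowProfile s L P I = τ := by
    refine (Nat.tendsto_div_const_atTop hK.ne').frequently ?_
    refine (hS.2.and_eventually (eventually_ge_atTop (k ^ t))).mono ?_
    rintro i ⟨hi, hi'⟩
    refine ⟨⟨i % k ^ t, Nat.mod_lt _ hK⟩, _, (Nat.one_le_div_iff hK).2 hi', ?_, rfl⟩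
    rwa [Nat.div_add_mod']
  rw [Filter.frequently_exists] at h1
  obtain ⟨w, h1⟩ := h1
  rw [Filter.frequently_exists] at h1
  obtain ⟨τ, h1⟩ := h1
  have h2 : ∃ᶠ I in atTop, windowProfile s L' P' I = τ :=
    (Set.ext_iff.1 he τ).1 (h1.mono fun I hI => hI.2.2)
  obtain ⟨I, hI1, hI2, hI3⟩ := h1.exists
  have h3 : Tendsto (fun I' => I' * k ^ t + (w : ℕ)) atTop atTop :=
    tendsto_atTop_mono (fun I' => (Nat.le_mul_of_pos_right I' hK).trans (Nat.le_add_right _ _))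
      tendsto_id
  refine h3.frequently ((h2.and_eventually (eventually_ge_atTop 1)).mono ?_)
  rintro I' ⟨hI', hI'1⟩
  exact hI2.of_windowProfile_eq ha h hk hI1 hI'1 (hI3.trans hI'.symm) hu hv w.2

/-! ### Bounded search for recurring repetitions -/

/-- A window of length at most `k ^ t` meets at most two consecutive blocks of length `k ^ t`. -/
theorem RepAt.of_pair_eq {Δ Q : Type*} {k : ℕ} {a : ℕ → Δ} {s : ℕ → Q} {o : Q → Δ}
    (ha : ∀ n, a n = o (s n)) (h : IsDigitStable k s) (hk : 2 ≤ k) {I I' : ℕ}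
    (hI : 1 ≤ I) (hI' : 1 ≤ I') (he : (s I, s (I + 1)) = (s I', s (I' + 1)))
    {t w l p : ℕ} (hw : w < k ^ t) (hlp : l + p ≤ k ^ t)
    (hr : RepAt a (I * k ^ t + w) l p) : RepAt a (I' * k ^ t + w) l p := by
  rw [Prod.mk.injEq] at he
  intro j h1 h2
  obtain ⟨d, rfl⟩ := Nat.exists_eq_add_of_le h1
  have h3 := hr (I * k ^ t + w + d) (by omega) (by omega)
  simp only [ha, add_assoc] at h3 ⊢
  rwa [← h.append_carry hk hI hI' he.1 he.2 (by omega),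
    ← h.append_carry hk hI hI' he.1 he.2 (by omega)]

/-- Pumping in the digits of the position above the lowest `t`: two truncations agree in the states
at themselves and at their successors, so the block between them can be removed or repeated. -/
theorem frequently_repAt_iff {Δ Q : Type*} [Finite Q] {k : ℕ} {a : ℕ → Δ} {s : ℕ → Q} {o : Q → Δ}
    (ha : ∀ n, a n = o (s n)) (h : IsDigitStable k s) (hk : 2 ≤ k) {M t l p : ℕ}
    (hM : Nat.card (Q × Q) ≤ M) (hlp : l + p ≤ k ^ t) :
    (∃ᶠ i in atTop, RepAt a i l p) ↔
      ∃ i, k ^ (t + M) ≤ i ∧ i < k ^ (t + M + M) ∧ RepAt a i l p := by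
  have hmono : ∀ {x y : ℕ}, x ≤ y → k ^ x ≤ k ^ y := Nat.pow_le_pow_right (by omega)
  have hpos : ∀ x, 0 < k ^ x := fun x => by positivity
  have key : ∀ i, k ^ (t + M) ≤ i → ∃ j₁ d, t + j₁ + (d + 1) ≤ t + M ∧
      (s (i / k ^ (t + j₁)), s (i / k ^ (t + j₁) + 1)) =
        (s (i / k ^ (t + j₁ + (d + 1))), s (i / k ^ (t + j₁ + (d + 1)) + 1)) ∧
      1 ≤ i / k ^ (t + j₁) ∧ 1 ≤ i / k ^ (t + j₁ + (d + 1)) := by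
    intro i hi
    obtain ⟨j₁, j₂, h12, h2, he⟩ := exists_lt_eq_of_card_le hM
      (fun j => (s (i / k ^ (t + j)), s (i / k ^ (t + j) + 1)))
    obtain ⟨d, rfl⟩ := Nat.exists_eq_add_of_lt h12
    rw [show t + (j₁ + d + 1) = t + j₁ + (d + 1) by omega] at he
    exact ⟨j₁, d, by omega, he,
      (Nat.one_le_div_iff (hpos _)).2 ((hmono (by omega)).trans hi),
      (Nat.one_le_div_iff (hpos _)).2 ((hmono (by omega)).trans hi)⟩
  constructor
  · intro hf
    have hex : ∃ i, k ^ (t + M) ≤ i ∧ RepAt a i l p :=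
      ((hf.and_eventually (eventually_ge_atTop _)).exists).imp fun _ hi => ⟨hi.2, hi.1⟩
    classical
    -- From a least position beyond the range, a block of at most `M` digits could be cut out,
    -- leaving a smaller one still at least `k ^ (t + M)`.
    obtain ⟨i, ⟨hi, hr⟩, hmin⟩ : ∃ i, (k ^ (t + M) ≤ i ∧ RepAt a i l p) ∧
        ∀ i' < i, ¬(k ^ (t + M) ≤ i' ∧ RepAt a i' l p) :=
      ⟨Nat.find hex, Nat.find_spec hex, fun _ => Nat.find_min hex⟩
    refine ⟨i, hi, ?_, hr⟩
    by_contra hbig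
    push Not at hbig
    obtain ⟨j₁, d, hd, he, h1, h2⟩ := key i hi
    set T := t + j₁ with hT
    rw [← Nat.div_add_mod' i (k ^ T)] at hr
    refine hmin _ ?_ ⟨?_, RepAt.of_pair_eq ha h hk h1 h2 he (Nat.mod_lt _ (hpos T))
      (hlp.trans (hmono (by omega))) hr⟩
    · have h3 := two_mul_div_pow_le (n := i) (t := T) hk (Nat.le_add_left 1 d)
      have h4 := Nat.mul_lt_mul_of_pos_right (by omega : i / k ^ (T + (d + 1)) < i / k ^ T)
        (hpos T)
      have h5 := Nat.div_add_mod' i (k ^ T)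
      omega
    · obtain ⟨e, he⟩ := Nat.exists_eq_add_of_le (by omega : T + (d + 1) ≤ t + M + M)
      have h3 : k ^ e ≤ i / k ^ (T + (d + 1)) := by
        rw [Nat.le_div_iff_mul_le (hpos _), ← pow_add, add_comm e, ← he]
        exact hbig
      calc k ^ (t + M) ≤ k ^ (e + T) := hmono (by omega)
        _ = k ^ e * k ^ T := pow_add _ _ _
        _ ≤ i / k ^ (T + (d + 1)) * k ^ T := Nat.mul_le_mul_right _ h3
        _ ≤ _ := Nat.le_add_right _ _
  · rintro ⟨i, hi, -, hr⟩
    have hall : ∀ n, ∃ i, n ≤ i ∧ k ^ (t + M) ≤ i ∧ RepAt a i l p := by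
      intro n
      induction n with
      | zero => exact ⟨i, Nat.zero_le _, hi, hr⟩
      | succ n ih =>
        obtain ⟨i, hn, hi, hr⟩ := ih
        obtain ⟨j₁, d, hd, he, h1, h2⟩ := key i hi
        set T := t + j₁ with hT
        rw [← Nat.div_add_mod' i (k ^ (T + (d + 1)))] at hr
        have h3 := two_mul_div_pow_le (n := i) (t := T) hk (Nat.le_add_left 1 d)
        have h4 := Nat.mul_lt_mul_of_pos_right (by omega : i / k ^ (T + (d + 1)) < i / k ^ T)
          (hpos (T + (d + 1)))
        have h5 := Nat.div_add_mod' i (k ^ (T + (d + 1)))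
        exact ⟨i / k ^ T * k ^ (T + (d + 1)) + i % k ^ (T + (d + 1)), by omega, by omega,
          RepAt.of_pair_eq ha h hk h2 h1 he.symm (Nat.mod_lt _ (hpos _))
            (hlp.trans (hmono (by omega))) hr⟩
    exact frequently_atTop.2 fun n => (hall n).imp fun i hi => ⟨hi.1, hi.2.2⟩

/-- Pairs of a recognised set with a ratio above a given one are recognised. -/
theorem IsDigitCongr.and_ratio_gt {C : Type*} {k : ℕ} {S : ℕ → ℕ → Prop} {c : ℕ → ℕ → C}
    (h : IsDigitCongr k S c) (x y : ℕ) :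
    IsDigitCongr k (fun l p => S l p ∧ x * p < l * y) (fun L P => (c L P,
      (⟨min (2 * (x + y)) (L * y + (x + y) - x * P), by omega⟩ : Fin (2 * (x + y) + 1)))) := by
  -- The class records `L * y - x * P` clipped to `[-(x + y), x + y]` and shifted to be natural.
  -- Appending `t` digits multiplies the difference by `k ^ t` and changes it by less than `(x + y)
  -- * k ^ t`, so beyond the clipping values the outcome of the comparison is settled.
  intro L P L' P' he t u v hu hv ⟨hS, hlt⟩
  simp only [Prod.mk.injEq, Fin.mk.injEq] at he
  refine ⟨h _ _ _ _ he.1 t u v hu hv hS, ?_⟩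
  have he := he.2
  have hxy : 1 ≤ x + y := by
    by_contra hc
    obtain ⟨rfl, rfl⟩ : x = 0 ∧ y = 0 := by omega
    simp at hlt
  generalize k ^ t = K at *
  have e1 : ∀ P, x * (P * K + v) = x * P * K + x * v := fun P => by ring
  have e2 : ∀ L, (L * K + u) * y = L * y * K + u * y := fun L => by ring
  rw [e1, e2] at *
  generalize L * y = A at *
  generalize L' * y = A' at *
  generalize x * P = E at *
  generalize x * P' = E' at *
  have hxv : x * v ≤ x * K := Nat.mul_le_mul_left _ hv.le
  have huy : u * y ≤ y * K := by rw [mul_comm]; exact Nat.mul_le_mul_left _ hu.le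
  by_cases h1 : A + (x + y) ≤ E
  · exfalso
    have h2 := Nat.mul_le_mul_right K h1
    have : (A + (x + y)) * K = A * K + x * K + y * K := by ring
    omega
  by_cases h2 : E + (x + y) ≤ A
  · have h3 : E' + (x + y) ≤ A' := by omega
    have h4 := Nat.mul_le_mul_right K h3
    have h5 : (E' + (x + y)) * K = E' * K + x * K + y * K := by ring
    have h6 : x * v < x * K ∨ 0 < y * K := by
      rcases Nat.eq_zero_or_pos y with rfl | hy
      · left
        exact Nat.mul_lt_mul_of_pos_left hv (by omega)
      · right
        exact Nat.mul_pos hy (by omega)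
    omega
  · rcases le_total A E with h3 | h3
    · obtain ⟨d, rfl⟩ := Nat.exists_eq_add_of_le h3
      obtain rfl : E' = A' + d := by omega
      rw [add_mul] at *
      omega
    · obtain ⟨d, rfl⟩ := Nat.exists_eq_add_of_le h3
      obtain rfl : A' = E' + d := by omega
      rw [add_mul] at *
      omega

/-- The number of classes of `repClass` for `m` states. -/
def repClassCard (m : ℕ) : ℕ := 2 * 2 ^ 2 ^ (16 * (m * (m * m)))

theorem card_repClass (Q : Type*) [Finite Q] :
    Nat.card (Prop × Set (Set ((Prop × Prop × Prop × Prop) × Q × Q × Q))) =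
      repClassCard (Nat.card Q) := by
  classical
  have := Fintype.ofFinite Q
  simp only [Nat.card_eq_fintype_card, Fintype.card_prod, Fintype.card_set, Fintype.card_prop,
    repClassCard]

theorem not_isRatioBound_iff {Δ Q : Type*} [Finite Q] {k : ℕ} {a : ℕ → Δ} {s : ℕ → Q} {o : Q → Δ}
    (ha : ∀ n, a n = o (s n)) (h : IsDigitStable k s) (hk : 2 ≤ k) {x y m N : ℕ}
    (hm : Nat.card Q = m) (hN : N = repClassCard m * (2 * (x + y) + 1)) :
    ¬ IsRatioBound (RepInf a) x y ↔
      ∃ l < k ^ N, ∃ p < k ^ N, (1 ≤ p ∧ x * p < l * y) ∧ ∃ i < k ^ (N + 1 + m * m + m * m),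
        k ^ (N + 1 + m * m) ≤ i ∧ ∀ j < l, a (i + j) = a (i + j + p) := by
  have hcard : Nat.card ((Prop × Set (Set ((Prop × Prop × Prop × Prop) × Q × Q × Q))) ×
      Fin (2 * (x + y) + 1)) ≤ N := by
    rw [Nat.card_prod, card_repClass, hm, Nat.card_fin, hN]
  have hrep : ∀ i l p, RepAt a i l p ↔ ∀ j < l, a (i + j) = a (i + j + p) := by
    intro i l p
    refine ⟨fun h j hj => h (i + j) (by omega) (by omega), fun h j h1 h2 => ?_⟩
    obtain ⟨d, rfl⟩ := Nat.exists_eq_add_of_le h1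
    exact h d (by omega)
  have hfreq : ∀ l p, l < k ^ N → p < k ^ N → ((∃ᶠ i in atTop, RepAt a i l p) ↔
      ∃ i < k ^ (N + 1 + m * m + m * m), k ^ (N + 1 + m * m) ≤ i ∧
        ∀ j < l, a (i + j) = a (i + j + p)) := by
    intro l p hl hp
    -- The exponent `N + 1` works because `l + p < 2 * k ^ N ≤ k ^ (N + 1)`.
    rw [frequently_repAt_iff ha h hk (M := m * m) (t := N + 1) (by rw [Nat.card_prod, hm])
      (by rw [pow_succ]; nlinarith)]
    simp only [hrep]
    exact exists_congr fun i => by tauto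
  constructor
  · intro hb
    unfold IsRatioBound at hb
    push Not at hb
    obtain ⟨l, p, hS, hlt⟩ := hb
    obtain ⟨l', p', hl', hp', hS', hlt'⟩ :=
      ((isDigitCongr_repInf ha h hk).and_ratio_gt x y).exists_lt_pow hk hcard (l := l) (p := p)
        ⟨hS, hlt⟩
    exact ⟨l', hl', p', hp', ⟨hS'.1, hlt'⟩, (hfreq _ _ hl' hp').1 hS'.2⟩
  · rintro ⟨l, hl, p, hp, ⟨hp1, hlt⟩, hi⟩ hb
    have := hb l p ⟨hp1, (hfreq _ _ hl hp).2 hi⟩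
    omega

/-- The critical exponent is infinite, or it is determined by a ratio of two bounded numbers. -/
theorem criticalExponentInf_eq_or {Δ Q : Type*} [Finite Q] {k : ℕ} {a : ℕ → Δ} {s : ℕ → Q}
    {o : Q → Δ} (ha : ∀ n, a n = o (s n)) (h : IsDigitStable k s) (hk : 2 ≤ k) :
    (criticalExponentInf a = ⊤ ∧ ∀ x y, 1 ≤ y → ¬ IsRatioBound (RepInf a) x y) ∨
      ∃ A E, A < k ^ repClassCard (Nat.card Q) ∧ 1 ≤ E ∧ E < k ^ repClassCard (Nat.card Q) ∧
        criticalExponentInf a = ((((A : ℚ) / (E : ℚ) + 1 : ℚ) : ℝ) : EReal) ∧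
        ∀ x y, IsRatioBound (RepInf a) x y ↔ A * y ≤ x * E := by
  rcases (isDigitCongr_repInf ha h hk).isRatioBound_iff hk (card_repClass Q).le
    (fun l p hlp => hlp.1) ⟨0, 1, repInf_zero_one a⟩ with hinf | ⟨A, E, hA, hE, hE', hiff⟩
  · left
    refine ⟨?_, hinf⟩
    by_contra hc
    obtain ⟨r, hr, -⟩ := EReal.lt_iff_exists_rat_btwn.1 (lt_top_iff_ne_top.2 hc)
    obtain ⟨n, hn⟩ := exists_nat_ge r
    refine hinf n 1 le_rfl ((criticalExponentInf_le_iff ha n le_rfl).1 (hr.le.trans ?_))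
    rw [EReal.coe_le_coe_iff, Rat.cast_le]
    simp only [Nat.cast_one, div_one]
    linarith
  · right
    refine ⟨A, E, hA, hE, hE', ?_, hiff⟩
    have hE0 : (0 : ℚ) < E := by exact_mod_cast hE
    have hle := (criticalExponentInf_le_iff ha A hE).2 ((hiff A E).2 le_rfl)
    refine le_antisymm hle (not_lt.1 fun hlt => ?_)
    obtain ⟨r, hr, hr'⟩ := EReal.lt_iff_exists_rat_btwn.1 hlt
    rw [EReal.coe_lt_coe_iff, Rat.cast_lt] at hr'
    have key : ∀ q : ℚ, r ≤ q + 1 → 0 ≤ q → (A : ℚ) / E ≤ q := by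
      intro q hrq hq
      obtain ⟨x, y, hy, rfl⟩ : ∃ x y : ℕ, 1 ≤ y ∧ q = (x : ℚ) / y := by
        refine ⟨q.num.toNat, q.den, q.pos, ?_⟩
        have : ((q.num.toNat : ℕ) : ℤ) = q.num := Int.toNat_of_nonneg (Rat.num_nonneg.2 hq)
        have h2 : ((q.num.toNat : ℕ) : ℚ) = (q.num : ℚ) := by exact_mod_cast this
        rw [h2, Rat.num_div_den]
      have hy0 : (0 : ℚ) < y := by exact_mod_cast hy
      have h1 := (hiff x y).1 ((criticalExponentInf_le_iff ha x hy).1 (hr.le.trans (by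
        rw [EReal.coe_le_coe_iff, Rat.cast_le]; exact hrq)))
      rw [div_le_div_iff₀ hE0 hy0]
      exact_mod_cast h1
    -- The maximum keeps the tested ratio nonnegative; if it is `0`, then `1 ≤ r` gives the
    -- contradiction.
    have h1 := key (max (r - 1) 0) (by linarith [le_max_left (r - 1) 0]) (le_max_right _ _)
    rcases max_cases (r - 1) 0 with ⟨h2, -⟩ | ⟨h2, h3⟩
    · rw [h2] at h1; linarith
    · have h4 := (one_le_criticalExponentInf ha).trans hr.le
      rw [← EReal.coe_one, EReal.coe_le_coe_iff] at h4
      have : (1 : ℚ) ≤ r := by exact_mod_cast h4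
      linarith

/-! The states of an automaton -/

/-- The state reached on reading the representation of `n`. -/
def DFAO.stateSeq {k : ℕ} {σ Δ : Type*} (M : DFAO k σ Δ) (hk : 2 ≤ k) (n : ℕ) : σ :=
  (canonicalEncoding k hk n).foldl M.step M.start

theorem DFAO.stateSeq_zero {k : ℕ} {σ Δ : Type*} (M : DFAO k σ Δ) (hk : 2 ≤ k) :
    M.stateSeq hk 0 = M.start := by
  simp [DFAO.stateSeq, canonicalEncoding]

theorem DFAO.stateSeq_of_pos {k : ℕ} {σ Δ : Type*} (M : DFAO k σ Δ) (hk : 2 ≤ k) {n : ℕ}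
    (hn : 0 < n) : M.stateSeq hk n =
      M.step (M.stateSeq hk (n / k)) ⟨n % k, Nat.mod_lt _ (by omega)⟩ := by
  have h := Nat.digits_def' (by omega : 1 < k) hn
  simp only [DFAO.stateSeq, canonicalEncoding, h, List.reverse_cons, List.pmap_append,
    List.pmap_cons, List.pmap_nil, List.foldl_append, List.foldl_cons, List.foldl_nil]

theorem DFAO.isDigitStable_stateSeq {k : ℕ} {σ Δ : Type*} (M : DFAO k σ Δ) (hk : 2 ≤ k) :
    IsDigitStable k (M.stateSeq hk) := by
  have key : ∀ X d (hd : d < k), 1 ≤ X →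
      M.stateSeq hk (X * k + d) = M.step (M.stateSeq hk X) ⟨d, hd⟩ := by
    intro X d hd hX
    have h1 : (X * k + d) / k = X := by
      rw [mul_comm, Nat.mul_add_div (by omega), Nat.div_eq_of_lt hd, add_zero]
    have h2 : (X * k + d) % k = d := by
      rw [mul_comm, Nat.mul_add_mod, Nat.mod_eq_of_lt hd]
    rw [M.stateSeq_of_pos hk (by nlinarith)]
    simp only [h1, h2]
  intro X X' d hX hX' hd he
  rw [key X d hd hX, key X' d hd hX', he]

/-! Evaluation of descriptions of automata -/

/-- The base of a description, with a meaningless base below `2` replaced by `2`. -/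
def codeBase (c : DFAOCode) : ℕ := c.1 - 2 + 2

/-- The state with number `q` of a description: its successors and its output. -/
def codeRow (c : DFAOCode) (q : ℕ) : List ℕ × ℕ := c.2.2.getD q ([], 0)

/-- The number of the state reached on reading the representation of `n`. -/
def codeState (c : DFAOCode) (n : ℕ) : ℕ :=
  if n = 0 then c.2.1
  else (codeRow c (codeState c (n / codeBase c))).1.getD (n % codeBase c) 0
termination_by n
decreasing_by exact Nat.div_lt_self (by omega) (by unfold codeBase; omega)

/-- The sequence generated by the automaton with the description `c`. -/
def codeSeq (c : DFAOCode) (n : ℕ) : ℕ := (codeRow c (codeState c n)).2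

theorem codeBase_code {k m : ℕ} (hk : 2 ≤ k) (M : DFAO k (Fin m) ℕ) : codeBase M.code = k := by
  simp only [codeBase, DFAO.code]
  omega

theorem codeRow_code {k m : ℕ} (M : DFAO k (Fin m) ℕ) (q : Fin m) :
    codeRow M.code q = (List.ofFn fun d : Fin k => (M.step q d : ℕ), M.output q) := by
  simp [codeRow, DFAO.code, List.getD_eq_getElem?_getD]

theorem codeState_code {k m : ℕ} (hk : 2 ≤ k) (M : DFAO k (Fin m) ℕ) (n : ℕ) :
    codeState M.code n = M.stateSeq hk n := by
  induction n using Nat.strong_induction_on with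
  | _ n ih =>
    rw [codeState]
    split_ifs with hn
    · rw [hn, M.stateSeq_zero]
      rfl
    · have h1 := Nat.mod_lt n (by omega : k > 0)
      rw [codeBase_code hk, ih _ (Nat.div_lt_self (by omega) (by omega)), codeRow_code,
        M.stateSeq_of_pos hk (Nat.pos_of_ne_zero hn)]
      simp [List.getD_eq_getElem?_getD, h1]

theorem codeSeq_code {k m : ℕ} (hk : 2 ≤ k) (M : DFAO k (Fin m) ℕ) :
    codeSeq M.code = M.sequence hk := by
  funext n
  rw [codeSeq, codeState_code hk, codeRow_code]
  rfl

theorem primrec_codeBase : Primrec codeBase :=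
  Primrec.nat_add.comp (Primrec.nat_sub.comp Primrec.fst (Primrec.const 2)) (Primrec.const 2)

theorem primrec_codeRow : Primrec₂ codeRow :=
  (Primrec.list_getD ([], 0)).comp (Primrec.snd.comp (Primrec.snd.comp Primrec.fst)) Primrec.snd

theorem primrec_codeState : Primrec₂ codeState := by
  -- Course-of-values recursion: `l` lists all earlier values, so its length is the current
  -- argument.
  let g : DFAOCode → List ℕ → ℕ := fun c l => if l.length = 0 then c.2.1 else
    (codeRow c (l.getD (l.length / codeBase c) 0)).1.getD (l.length % codeBase c) 0
  have hlen : Primrec fun p : DFAOCode × List ℕ => p.2.length :=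
    Primrec.list_length.comp Primrec.snd
  have hbase : Primrec fun p : DFAOCode × List ℕ => codeBase p.1 :=
    primrec_codeBase.comp Primrec.fst
  have hg : Primrec₂ g :=
    Primrec.ite (Primrec.eq.comp hlen (Primrec.const 0))
      (Primrec.fst.comp (Primrec.snd.comp Primrec.fst))
      ((Primrec.list_getD 0).comp (Primrec.fst.comp (primrec_codeRow.comp Primrec.fst
        ((Primrec.list_getD 0).comp Primrec.snd (Primrec.nat_div.comp hlen hbase))))
        (Primrec.nat_mod.comp hlen hbase))
  refine Primrec.nat_strong_rec codeState (g := fun c l => some (g c l))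
    (Primrec.option_some.comp₂ hg) fun c n => ?_
  simp only [g, List.length_map, List.length_range]
  rw [codeState]
  split_ifs with hn
  · rfl
  · have h1 : n / codeBase c < n := Nat.div_lt_self (by omega) (by unfold codeBase; omega)
    simp [List.getD_eq_getElem?_getD, h1]

theorem primrec_codeSeq : Primrec₂ codeSeq :=
  Primrec.snd.comp (primrec_codeRow.comp Primrec.fst primrec_codeState)

/-! Computation of the critical exponent -/

theorem PrimrecPred.exists_lt_bound {α : Type*} [Primcodable α] {b : α → ℕ} {R : α → ℕ → Prop}
    (hb : Primrec b) (hR : PrimrecPred fun q : α × ℕ => R q.1 q.2) :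
    PrimrecPred fun a => ∃ n < b a, R a n :=
  ((PrimrecRel.exists_mem_list (R := fun (n : ℕ) (a : α) => R a n)
    (hR.comp (Primrec.pair Primrec.snd Primrec.fst))).comp (Primrec.list_range.comp hb)
      Primrec.id).of_eq fun a => by simp

theorem PrimrecPred.forall_lt_bound {α : Type*} [Primcodable α] {b : α → ℕ} {R : α → ℕ → Prop}
    (hb : Primrec b) (hR : PrimrecPred fun q : α × ℕ => R q.1 q.2) :
    PrimrecPred fun a => ∀ n < b a, R a n :=
  ((PrimrecRel.forall_mem_list (R := fun (n : ℕ) (a : α) => R a n)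
    (hR.comp (Primrec.pair Primrec.snd Primrec.fst))).comp (Primrec.list_range.comp hb)
      Primrec.id).of_eq fun a => by simp

theorem primrec_nat_pow : Primrec₂ ((· ^ ·) : ℕ → ℕ → ℕ) :=
  Primrec₂.unpaired'.1 Nat.Primrec.pow

theorem primrec_factorial : Primrec Nat.factorial :=
  (Primrec.nat_rec₁ (f := fun n ih => (n + 1) * ih) 1
    (Primrec.nat_mul.comp (Primrec.succ.comp Primrec.fst) Primrec.snd)).of_eq fun n => by
      induction n with
      | zero => rfl
      | succ n ih => rw [Nat.factorial_succ, ← ih]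

theorem primrec_repClassCard : Primrec repClassCard :=
  Primrec.nat_mul.comp (Primrec.const 2) (primrec_nat_pow.comp (Primrec.const 2)
    (primrec_nat_pow.comp (Primrec.const 2) (Primrec.nat_mul.comp (Primrec.const 16)
      (Primrec.nat_mul.comp Primrec.id (Primrec.nat_mul.comp Primrec.id Primrec.id)))))

/-- The number of states of a description. -/
def codeSize (c : DFAOCode) : ℕ := c.2.2.length

theorem primrec_codeSize : Primrec codeSize :=
  Primrec.list_length.comp (Primrec.snd.comp Primrec.snd)

/-- A number of digits that suffices to find a repetition with a ratio above `x / y`. -/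
def digitBound (q : DFAOCode × ℕ × ℕ) : ℕ :=
  repClassCard (codeSize q.1) * (2 * (q.2.1 + q.2.2) + 1)

theorem primrec_digitBound : Primrec digitBound :=
  Primrec.nat_mul.comp (primrec_repClassCard.comp (primrec_codeSize.comp Primrec.fst))
    (Primrec.nat_add.comp (Primrec.nat_mul.comp (Primrec.const 2)
      (Primrec.nat_add.comp (Primrec.fst.comp Primrec.snd) (Primrec.snd.comp Primrec.snd)))
      (Primrec.const 1))

/-- A bounded search finds a repetition with a ratio above `x / y` in the sequence described
by `c`, where `q = (c, x, y)`. -/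
def ExceedsRatio (q : DFAOCode × ℕ × ℕ) : Prop :=
  ∃ l < codeBase q.1 ^ digitBound q, ∃ p < codeBase q.1 ^ digitBound q,
    (1 ≤ p ∧ q.2.1 * p < l * q.2.2) ∧
    ∃ i < codeBase q.1 ^ (digitBound q + 1 + codeSize q.1 * codeSize q.1 +
        codeSize q.1 * codeSize q.1),
      codeBase q.1 ^ (digitBound q + 1 + codeSize q.1 * codeSize q.1) ≤ i ∧
        ∀ j < l, codeSeq q.1 (i + j) = codeSeq q.1 (i + j + p)

theorem primrecPred_exceedsRatio : PrimrecPred ExceedsRatio := by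
  have hk : Primrec fun q : DFAOCode × ℕ × ℕ => codeBase q.1 := primrec_codeBase.comp Primrec.fst
  have hm : Primrec fun q : DFAOCode × ℕ × ℕ => codeSize q.1 * codeSize q.1 :=
    Primrec.nat_mul.comp (primrec_codeSize.comp Primrec.fst) (primrec_codeSize.comp Primrec.fst)
  have hY : Primrec fun q : DFAOCode × ℕ × ℕ => codeBase q.1 ^ digitBound q :=
    primrec_nat_pow.comp hk primrec_digitBound
  have hm1 : Primrec fun q : DFAOCode × ℕ × ℕ =>
      digitBound q + 1 + codeSize q.1 * codeSize q.1 :=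
    Primrec.nat_add.comp (Primrec.succ.comp primrec_digitBound) hm
  have hW : Primrec fun q : DFAOCode × ℕ × ℕ =>
      codeBase q.1 ^ (digitBound q + 1 + codeSize q.1 * codeSize q.1) :=
    primrec_nat_pow.comp hk hm1
  have hW' : Primrec fun q : DFAOCode × ℕ × ℕ =>
      codeBase q.1 ^ (digitBound q + 1 + codeSize q.1 * codeSize q.1 +
        codeSize q.1 * codeSize q.1) :=
    primrec_nat_pow.comp hk (Primrec.nat_add.comp hm1 hm)
  refine PrimrecPred.exists_lt_bound hY (PrimrecPred.exists_lt_bound (hY.comp Primrec.fst)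
    (PrimrecPred.and (PrimrecPred.and
      (Primrec.nat_le.comp (Primrec.const 1) Primrec.snd)
      (Primrec.nat_lt.comp
        (Primrec.nat_mul.comp (Primrec.fst.comp (Primrec.snd.comp (Primrec.fst.comp Primrec.fst)))
          Primrec.snd)
        (Primrec.nat_mul.comp (Primrec.snd.comp Primrec.fst)
          (Primrec.snd.comp (Primrec.snd.comp (Primrec.fst.comp Primrec.fst))))))
      (PrimrecPred.exists_lt_bound (hW'.comp (Primrec.fst.comp Primrec.fst))
        (PrimrecPred.and
          (Primrec.nat_le.comp (hW.comp (Primrec.fst.comp (Primrec.fst.comp Primrec.fst)))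
            Primrec.snd)
          (PrimrecPred.forall_lt_bound
            (Primrec.snd.comp (Primrec.fst.comp Primrec.fst)) ?_)))))
  have hc : Primrec fun r : ((((DFAOCode × ℕ × ℕ) × ℕ) × ℕ) × ℕ) × ℕ => r.1.1.1.1.1 :=
    Primrec.fst.comp (Primrec.fst.comp (Primrec.fst.comp (Primrec.fst.comp Primrec.fst)))
  have hij : Primrec fun r : ((((DFAOCode × ℕ × ℕ) × ℕ) × ℕ) × ℕ) × ℕ => r.1.2 + r.2 :=
    Primrec.nat_add.comp (Primrec.snd.comp Primrec.fst) Primrec.snd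
  exact Primrec.eq.comp (primrec_codeSeq.comp hc hij)
    (primrec_codeSeq.comp hc (Primrec.nat_add.comp hij
      (Primrec.snd.comp (Primrec.fst.comp Primrec.fst))))

theorem exceedsRatio_code_iff {k m : ℕ} (hk : 2 ≤ k) (M : DFAO k (Fin m) ℕ) (x y : ℕ) :
    ExceedsRatio (M.code, x, y) ↔ ¬ IsRatioBound (RepInf (M.sequence hk)) x y := by
  have hs : codeSize M.code = m := by simp [codeSize, DFAO.code]
  rw [not_isRatioBound_iff (a := M.sequence hk) (s := M.stateSeq hk) (o := M.output)
    (fun _ => rfl) (M.isDigitStable_stateSeq hk) hk (Nat.card_fin m) (N := digitBound (M.code, x, y))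
    (by simp only [digitBound, hs])]
  simp only [ExceedsRatio, codeBase_code hk, codeSeq_code hk, hs]

/-- A bound for the numerator and the denominator of a finite critical exponent minus one. -/
def ratioBound (c : DFAOCode) : ℕ := codeBase c ^ repClassCard (codeSize c)

theorem primrec_ratioBound : Primrec ratioBound :=
  primrec_nat_pow.comp primrec_codeBase (primrec_repClassCard.comp primrec_codeSize)

open Classical in
/-- The critical exponent of the sequence with the description `c`, as a fraction. -/
noncomputable def criticalExponentOfCode (c : DFAOCode) : Option (ℕ × ℕ) :=
  if ExceedsRatio (c, ratioBound c, 1) then none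
  else
    some ((List.range (ratioBound c * (ratioBound c).factorial)).findIdx
      (fun z => !decide (ExceedsRatio (c, z, (ratioBound c).factorial))) +
        (ratioBound c).factorial, (ratioBound c).factorial)

theorem primrec_criticalExponentOfCode : Primrec criticalExponentOfCode := by
  classical
  have hD : Primrec fun c => (ratioBound c).factorial := primrec_factorial.comp primrec_ratioBound
  refine Primrec.ite (primrecPred_exceedsRatio.comp
    (Primrec.pair Primrec.id (Primrec.pair primrec_ratioBound (Primrec.const 1))))
    (Primrec.const none) (Primrec.option_some.comp (Primrec.pair (Primrec.nat_add.comp ?_ hD) hD))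
  refine Primrec.list_findIdx (Primrec.list_range.comp (Primrec.nat_mul.comp primrec_ratioBound hD))
    (Primrec.not.comp₂ ?_)
  exact (primrecPred_exceedsRatio.comp (Primrec.pair Primrec.fst
    (Primrec.pair Primrec.snd (hD.comp Primrec.fst)))).decide

/-- A finite value `A / E + 1` has `A < B` and `1 ≤ E < B`. So exceeding `B` means infinity, and `E`
divides `B!`, which serves as common denominator. -/
theorem isExactValue_criticalExponentOfCode {k m : ℕ} (hk : 2 ≤ k) (M : DFAO k (Fin m) ℕ) :
    IsExactValue (criticalExponentInf (M.sequence hk)) (criticalExponentOfCode M.code) := by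
  classical
  have hB : ratioBound M.code = k ^ repClassCard (Nat.card (Fin m)) := by
    have hs : codeSize M.code = m := by simp [codeSize, DFAO.code]
    rw [ratioBound, codeBase_code hk, hs, Nat.card_fin]
  have hmain := criticalExponentInf_eq_or (a := M.sequence hk) (s := M.stateSeq hk) (o := M.output)
    (fun _ => rfl) (M.isDigitStable_stateSeq hk) hk
  rw [← hB] at hmain
  unfold criticalExponentOfCode
  simp only [exceedsRatio_code_iff hk]
  generalize ratioBound M.code = B at *
  rcases hmain with ⟨htop, hinf⟩ | ⟨A, E, hA, hE, hE', heq, hiff⟩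
  · rw [if_pos (hinf B 1 le_rfl)]
    exact htop
  · have hb : IsRatioBound (RepInf (M.sequence hk)) B 1 := by
      rw [hiff]
      nlinarith
    rw [if_neg (not_not.2 hb)]
    simp only [hiff, decide_not, Bool.not_not]
    obtain ⟨d, hd⟩ := Nat.dvd_factorial hE hE'.le
    have hD := Nat.factorial_pos B
    generalize B.factorial = D at *
    have hd0 : 0 < d := Nat.pos_of_ne_zero (by rintro rfl; omega)
    have hlt : A * d < B * D := by
      rw [hd]
      exact Nat.mul_lt_mul_of_lt_of_le hA (Nat.le_mul_of_pos_left d hE) (Nat.mul_pos hE hd0)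
    -- The least upper bound with denominator `D = E * d` is exactly `A * d / D`, and `hlt` places
    -- `A * d` in the searched range.
    have hz : (List.range (B * D)).findIdx (fun z => decide (A * D ≤ z * E)) = A * d := by
      rw [List.findIdx_eq (by simpa using hlt)]
      simp only [List.getElem_range, decide_eq_true_eq, decide_eq_false_iff_not, hd]
      refine ⟨le_of_eq (by ring), fun j hj hle => ?_⟩
      have : A * d * E ≤ j * E := le_trans (le_of_eq (by ring)) hle
      exact absurd (Nat.le_of_mul_le_mul_right this hE) (by omega)
    rw [hz]
    refine ⟨hD, ?_⟩
    rw [heq]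
    congr 2
    have hE0 : (E : ℚ) ≠ 0 := by exact_mod_cast (Nat.pos_iff_ne_zero.1 hE)
    have hd0' : (d : ℚ) ≠ 0 := by exact_mod_cast hd0.ne'
    rw [hd]
    push_cast
    field_simp

theorem mainTheorem7 :
    (∀ (k : ℕ) (Δ : Type*) [Finite Δ] (a : ℕ → Δ), IsAutomatic k a →
      (∃ r : ℚ, criticalExponentInf a = ((r : ℝ) : EReal)) ∨ criticalExponentInf a = ⊤) ∧
    (∃ f : DFAOCode → Option (ℕ × ℕ), Computable f ∧
      ∀ (k : ℕ) (hk : 2 ≤ k) (m : ℕ) (M : DFAO k (Fin m) ℕ),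
        IsExactValue (criticalExponentInf (M.sequence hk)) (f M.code)) := by
  refine ⟨?_, criticalExponentOfCode, primrec_criticalExponentOfCode.to_comp,
    fun k hk m M => isExactValue_criticalExponentOfCode hk M⟩
  rintro k Δ _ a ⟨hk, σ, _, M, ha⟩
  rcases criticalExponentInf_eq_or (s := M.stateSeq hk) (o := M.output) ha
    (M.isDigitStable_stateSeq hk) hk with h | ⟨A, E, -, -, -, h, -⟩
  · exact Or.inr h.1
  · exact Or.inl ⟨_, h⟩
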